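/- Let $n\in\{0,1,2,\dots\}\cup\{\infty\}$. There is a nonmetrizable compact Hausdorff space $K$ such that every nonmetrizable compact subspace $L\subseteq K$ has covering dimension exactly $n$ and contains a homeomorphic copy of the cube $[0,1]^n$ (where $[0,1]^\infty=[0,1]^{\mathbb N}$, and $[0,1]^0$ is a point). Moreover, for $n\ge 1$ the space $K$ can be taken to be a split interval with splitting functions into $[0,1]^n$. That is, there are distinct points $r_\xi\in[0,1]$ $(\xi\in I)$ and continuous functions $f_\xi:[0,1]\setminus\{r_\xi\}\to[0,1]^n$ such that $f_\xi[U\setminus\{r_\xi\}]$ is dense in $[0,1]^n$ for every open neighbourhood $U$ of $r_\xi$ in $[0,1]$, and $K$ is (homeomorphic to) the subspace $$\{(m,x)\in[0,1]\times([0,1]^n)^I:\ x(\xi)=f_\xi(m)\ \text{ for all }\xi\in I\text{ with } r_\xi\ne m\}$$ of the product $[0,1]\times([0,1]^n)^I$. Here the covering dimension of a nonempty compact Hausdorff space $X$ is the least integer $d\ge 0$ such that every finite open cover of $X$ has a finite open refinement covering $X$ in which each point of $X$ lies in at most $d+1$ members; it is $\infty$ if there is no such $d$. -/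

import Mathlib

open Set Topology

/-- The data of a splitting of a space `M`: distinct points `r ξ` of `M` and continuous splitting
functions `f ξ : M \ {r ξ} → K ξ`, each of which maps every punctured neighbourhood of `r ξ` onto a
dense subset of `K ξ`. The indices `ξ` range over an arbitrary type `ι`; as the points are distinct,
the cardinality of `ι` is at most that of `M` (so at most the continuum if `M` is `[0,1]`). -/
structure SplittingFamily (M : Type*) [TopologicalSpace M] {ι : Type*} (K : ι → Type*)
    [∀ ξ, TopologicalSpace (K ξ)] where
  r : ι → M
  r_injective : Function.Injective r
  f : ∀ ξ, {x : M // x ≠ r ξ} → K ξ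
  continuous_f : ∀ ξ, Continuous (f ξ)
  dense_image : ∀ ξ, ∀ U : Set M, IsOpen U → r ξ ∈ U → Dense (f ξ '' {x | (x : M) ∈ U})

/-- The split `M` induced by the splitting functions, as a subset of the product
`M × ∏ ξ, K ξ`. A point `(m, x)` belongs to it if `x ξ = f ξ m` for every `ξ` with `m ≠ r ξ`. So over
`m ∉ {r ξ}` there is exactly one point, and over `m = r ξ` there is one point for every `t` in `K ξ`,
with `ξ`-th coordinate `t` and `η`-th coordinate `f η (r ξ)` for `η ≠ ξ`. It is regarded as
a topological space with the subspace topology. -/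
def SplittingFamily.split {M : Type*} [TopologicalSpace M] {ι : Type*} {K : ι → Type*}
    [∀ ξ, TopologicalSpace (K ξ)] (S : SplittingFamily M K) : Set (M × (∀ ξ, K ξ)) :=
  {p | ∀ ξ, ∀ h : p.1 ≠ S.r ξ, p.2 ξ = S.f ξ ⟨p.1, h⟩}

/-- The cube `[0,1]^n` with the product topology, for `n` a natural number or `∞`;
for `n = ∞` the coordinates are indexed by all natural numbers. -/
abbrev Cube (n : ℕ∞) : Type := {i : ℕ // (i : ℕ∞) < n} → unitInterval

/-- Every finite open cover of `X` has a finite open refinement, again a cover, such that every point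
lies in at most `n + 1` of its members. -/
def CoveringDimLE (X : Type*) [TopologicalSpace X] (n : ℕ) : Prop :=
  ∀ 𝒰 : Set (Set X), 𝒰.Finite → (∀ U ∈ 𝒰, IsOpen U) → ⋃₀ 𝒰 = univ →
    ∃ 𝒱 : Set (Set X), 𝒱.Finite ∧ (∀ V ∈ 𝒱, IsOpen V) ∧ ⋃₀ 𝒱 = univ ∧
      (∀ V ∈ 𝒱, ∃ U ∈ 𝒰, V ⊆ U) ∧ ∀ x, {V ∈ 𝒱 | x ∈ V}.encard ≤ n + 1

open Classical in
/-- The (Čech–Lebesgue) covering dimension. The value for the empty space, usually written `-1`,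
is `⊥`; the value is `⊤` if `CoveringDimLE X n` fails for every `n`. -/
noncomputable def coveringDim (X : Type*) [TopologicalSpace X] : WithBot ℕ∞ :=
  if IsEmpty X then ⊥ else ((⨅ n : {n : ℕ // CoveringDimLE X n}, ((n : ℕ) : ℕ∞) : ℕ∞) : WithBot ℕ∞)

/-!
For `n ≥ 1` the space is a split interval with one splitting point `r F` for each uncountable closed
set `F ⊆ [0,1]`. There are only continuum many such sets, and each contains a perfect set of size
continuum, so the points `r F` can be chosen distinct and such that `F` accumulates at `r F`
(`exists_injective_choice`). Prescribing values on a sequence in `F` that converges to `r F`, Tietze's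
theorem gives a splitting function that maps `F ∩ U \ {r F}` onto a dense set for every neighbourhood
`U` of `r F` (`exists_splitting_function`).

Let `L` be a compact subspace with projection `F` to `[0,1]`. If `F` is countable, then `L` embeds in a
countable product and is metrizable. Otherwise `F` is one of the sets of the construction, and the
choice of the splitting function forces the whole fibre over `r F`, a copy of `[0,1]^n`, into `L`
(`SplittingFamily.fibrePoint_mem_of_isCompact`). So everything comes down to two bounds.

* The split has dimension at most `n` (`SplittingFamily.coveringDimLE_split`). A finite cover depends on
  finitely many coordinates, and the projection to these consists of finitely many subsets of
  `[0,1]^n` and a rest whose closed subsets embed in `[0,1]`. The stars of the vertices of the Kuhn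
  triangulation show that the cube `[0,1]^n` has dimension at most `n` (`coveringDimLE_cube`).
* The cube `[0,1]^(m+1)` does not have dimension at most `m` (`not_coveringDimLE_cube`). This is Lebesgue's
  covering theorem, derived from a Sperner lemma for the Kuhn triangulation of the grid. Rainbow
  simplices are counted modulo 2, and their indicator is written as a determinant over `ZMod 2`, so
  that expansion along a column turns the count into a sum over facets, in which inner facets cancel.

The split is not metrizable as it has an uncountable family of real functions with mutual distances at
least `1 / 2`. For `n = 0` the space `ℝ → Bool` will do.
-/

/-! ### The Kuhn triangulation and the parity of its rainbow simplices -/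

/-- The determinant mod 2 of the matrix whose entry at `(j, a)` tells whether the `j`-th label `p j`
is `a`. It is an algebraic form of the indicator of `p` being a bijection onto `{0, …, d}`. -/
def rainbow (d : ℕ) (p : Fin (d + 1) → ℕ) : ZMod 2 :=
  (Matrix.of fun j a : Fin (d + 1) => if p j = (a : ℕ) then (1 : ZMod 2) else 0).det

lemma rainbow_eq_zero_of_missing {d : ℕ} {p : Fin (d + 1) → ℕ} (a : ℕ) (ha : a ≤ d)
    (h : ∀ j, p j ≠ a) : rainbow d p = 0 := by
  refine Matrix.det_eq_zero_of_column_eq_zero ⟨a, by omega⟩ fun j => ?_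
  simp [h j]

/-- The indicator of rainbow simplices is, modulo 2, the sum of the indicators of rainbow facets:
as each row of the matrix contains a single `1`, adding all columns to the last one turns that into
the constant `1`, along which the determinant is expanded. -/
lemma rainbow_succ {d : ℕ} {p : Fin (d + 2) → ℕ} (hp : ∀ j, p j ≤ d + 1) :
    rainbow (d + 1) p = ∑ j : Fin (d + 2), rainbow d (p ∘ j.succAbove) := by
  set M : Matrix (Fin (d + 2)) (Fin (d + 2)) (ZMod 2) :=
    Matrix.of fun j a => if p j = (a : ℕ) then (1 : ZMod 2) else 0 with hM
  have h1 := Matrix.det_updateCol_sum M (Fin.last _) (fun _ => 1)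
  have hone : (fun k => ∑ i, (1 : ZMod 2) • M k i) = fun _ => 1 := by
    funext k
    rw [Finset.sum_eq_single ⟨p k, by have := hp k; omega⟩]
    · simp [hM]
    · intro b _ hb
      have : p k ≠ (b : ℕ) := fun h => hb (Fin.ext h.symm)
      simp [hM, this]
    · simp
  rw [hone, one_smul] at h1
  change M.det = _
  rw [← h1, Matrix.det_succ_column _ (Fin.last _)]
  refine Finset.sum_congr rfl fun j _ => ?_
  have hneg : (-1 : ZMod 2) = 1 := by decide
  rw [hneg, one_pow, one_mul, Matrix.updateCol_self, one_mul, rainbow]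
  congr 1
  ext i a
  rw [Matrix.submatrix_apply, Fin.succAbove_last, Matrix.updateCol_ne (Fin.castSucc_lt_last a).ne]
  simp [hM]

/-- The vertices `x_0 > x_1 > … > x_d` of a simplex of the Kuhn triangulation of the grid: it starts
at `x_0 = q + (1, …, 1)`, and the coordinate `i` drops by `1` in the step from `x_(τ i)` to
`x_(τ i + 1)`. -/
def kuhnPath {d : ℕ} (q : Fin d → ℕ) (τ : Equiv.Perm (Fin d)) (j : Fin (d + 1)) : Fin d → ℕ :=
  fun i => q i + if (j : ℕ) ≤ τ i then 1 else 0

/-- The number modulo 2 of rainbow simplices in the Kuhn triangulation of the grid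
`{0, …, M + 1}^d`, for the labelling `l`. -/
def rainbowCount (M d : ℕ) (l : (Fin d → ℕ) → ℕ) : ZMod 2 :=
  ∑ τ : Equiv.Perm (Fin d), ∑ q : Fin d → Fin (M + 1),
    rainbow d fun j => l (kuhnPath (fun i => (q i : ℕ)) τ j)

/-- The labellings to which the cubical form of Sperner's lemma applies. The coordinate `i` belongs to
the label `d - 1 - i`: that label does not occur on the face `x i = M + 1`, and no greater label
occurs on the face `x i = 0`. -/
structure IsSpernerLabelling (M d : ℕ) (l : (Fin d → ℕ) → ℕ) : Prop where
  le : ∀ x, (∀ i, x i ≤ M + 1) → l x ≤ d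
  zero : ∀ x, (∀ i, x i ≤ M + 1) → ∀ i : Fin d, x i = 0 → l x + i + 1 ≤ d
  top : ∀ x, (∀ i, x i ≤ M + 1) → ∀ i : Fin d, x i = M + 1 → l x + i + 1 ≠ d

lemma kuhnPath_le {M d : ℕ} (q : Fin d → Fin (M + 1)) (τ : Equiv.Perm (Fin d)) (j : Fin (d + 1))
    (i : Fin d) : kuhnPath (fun i => (q i : ℕ)) τ j i ≤ M + 1 := by
  have := (q i).2
  simp only [kuhnPath]
  split_ifs <;> omega

/-- A facet opposite to an inner vertex is shared by two simplices based at the same point. -/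
lemma sum_inner_facets {d : ℕ} (q : Fin (d + 1) → ℕ) (l : (Fin (d + 1) → ℕ) → ℕ)
    (k : Fin d) :
    ∑ τ : Equiv.Perm (Fin (d + 1)),
      rainbow d ((fun j => l (kuhnPath q τ j)) ∘ (k.castSucc.succ).succAbove) = 0 := by
  have key : ∀ τ : Equiv.Perm (Fin (d + 1)),
      (fun j => l (kuhnPath q (Equiv.swap k.castSucc k.succ * τ) j)) ∘ (k.castSucc.succ).succAbove
        = (fun j => l (kuhnPath q τ j)) ∘ (k.castSucc.succ).succAbove := by
    intro τ
    funext j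
    simp only [Function.comp_apply]
    congr 1
    funext i
    simp only [kuhnPath, Equiv.Perm.mul_apply]
    have hj : (((k.castSucc.succ).succAbove j : Fin (d + 2)) : ℕ) ≠ k + 1 := by
      intro h
      exact Fin.succAbove_ne (k.castSucc.succ) j (Fin.ext (by simpa using h))
    congr 2
    rcases eq_or_ne (τ i) k.castSucc with h | h
    · rw [h, Equiv.swap_apply_left]
      simp only [Fin.val_succ, Fin.val_castSucc, eq_iff_iff]
      omega
    rcases eq_or_ne (τ i) k.succ with h' | h'
    · rw [h', Equiv.swap_apply_right]
      simp only [Fin.val_succ, Fin.val_castSucc, eq_iff_iff]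
      omega
    · rw [Equiv.swap_apply_of_ne_of_ne h h']
  refine Finset.sum_involution (fun τ _ => Equiv.swap k.castSucc k.succ * τ) ?_ ?_ ?_ ?_
  · intro τ _
    rw [key]
    exact CharTwo.add_self_eq_zero _
  · intro τ _ _ h
    have h2 : Equiv.swap k.castSucc k.succ = (1 : Equiv.Perm (Fin (d + 1))) := by
      simpa using h
    have h3 := Equiv.swap_eq_one_iff.1 h2
    simp [Fin.ext_iff] at h3
  · simp
  · intro τ _
    simp [← mul_assoc]

/-- The facet opposite to the last vertex is the facet opposite to the first vertex of the simplex
which is next in the direction of the coordinate that drops last, unless there is none in the grid;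
then the facet lies in the face `x i = M + 1` for this coordinate `i`, where a label is missing. -/
lemma rainbow_facet_last {M d : ℕ} {l : (Fin (d + 1) → ℕ) → ℕ}
    (hl : IsSpernerLabelling M (d + 1) l) (q : Fin (d + 1) → Fin (M + 1))
    (τ : Equiv.Perm (Fin (d + 1))) (i₀ : Fin (d + 1))
    (hi₀ : τ i₀ = Fin.last d) :
    rainbow d ((fun j => l (kuhnPath (fun i => (q i : ℕ)) τ j)) ∘ (Fin.last (d + 1)).succAbove) =
      if (q + Pi.single i₀ 1 : Fin (d + 1) → Fin (M + 1)) i₀ = 0 then 0 else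
      rainbow d ((fun j => l (kuhnPath
        (fun i => ((q + Pi.single i₀ 1 : Fin (d + 1) → Fin (M + 1)) i : ℕ)) (Equiv.addRight 1 * τ) j)) ∘
        (0 : Fin (d + 2)).succAbove) := by
  have hq0 : ∀ i, i ≠ i₀ → (q + Pi.single i₀ 1 : Fin (d + 1) → Fin (M + 1)) i = q i := by
    intro i hi
    simp [hi]
  have hq1 : (q + Pi.single i₀ 1 : Fin (d + 1) → Fin (M + 1)) i₀ = q i₀ + 1 := by simp
  rw [hq1]
  split_ifs with h
  · have hM : (q i₀ : ℕ) = M := by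
      have h2 : q i₀ = Fin.last M := by
        by_contra hne
        have := congrArg Fin.val h
        rw [Fin.val_add_one_of_lt (Fin.lt_last_iff_ne_last.2 hne)] at this
        simp at this
      rw [h2]; rfl
    refine rainbow_eq_zero_of_missing (d - i₀) (by omega) fun j hj => ?_
    refine hl.top _ (kuhnPath_le q τ j.castSucc) i₀ ?_ ?_
    · simp only [kuhnPath, hi₀, hM, Fin.val_last, Fin.val_castSucc]
      rw [if_pos (by omega)]
    · simp only [Function.comp_apply, Fin.succAbove_last] at hj
      have := i₀.2
      omega
  · have hM : ((q i₀ + 1 : Fin (M + 1)) : ℕ) = q i₀ + 1 := by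
      refine Fin.val_add_one_of_lt (Fin.lt_last_iff_ne_last.2 fun h2 => h ?_)
      rw [h2, Fin.last_add_one]
    congr 1
    funext j
    simp only [Function.comp_apply, Fin.succAbove_last, Fin.succAbove_zero]
    congr 1
    funext i
    simp only [kuhnPath]
    rcases eq_or_ne i i₀ with rfl | hi
    · have h1 : (Equiv.addRight 1 * τ : Equiv.Perm (Fin (d + 1))) i = 0 := by simp [hi₀]
      rw [hq1, hM, hi₀, h1, if_pos (by simp; omega), if_neg (by simp)]
    · have hlt : τ i < Fin.last d :=
        Fin.lt_last_iff_ne_last.2 fun h2 => hi (τ.injective (h2.trans hi₀.symm))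
      have h1 : ((Equiv.addRight 1 * τ : Equiv.Perm (Fin (d + 1))) i : ℕ) = τ i + 1 := by
        simp [Fin.val_add_one_of_lt hlt]
      rw [hq0 i hi, h1]
      simp

/-- The rainbow simplices of the grid are, modulo 2, as many as the rainbow simplices of its face
`x 0 = 0`. -/
lemma rainbowCount_succ {M d : ℕ} {l : (Fin (d + 1) → ℕ) → ℕ}
    (hl : IsSpernerLabelling M (d + 1) l) :
    rainbowCount M (d + 1) l = rainbowCount M d (fun x => l (Fin.cons 0 x)) := by
  set F : Equiv.Perm (Fin (d + 1)) → (Fin (d + 1) → Fin (M + 1)) → ZMod 2 := fun τ q =>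
    rainbow d ((fun j => l (kuhnPath (fun i => (q i : ℕ)) τ j)) ∘ (0 : Fin (d + 2)).succAbove)
    with hF
  have hlast : ∑ τ : Equiv.Perm (Fin (d + 1)), ∑ q : Fin (d + 1) → Fin (M + 1),
      rainbow d ((fun j => l (kuhnPath (fun i => (q i : ℕ)) τ j)) ∘ (Fin.last (d + 1)).succAbove) =
      ∑ τ : Equiv.Perm (Fin (d + 1)), ∑ q : Fin (d + 1) → Fin (M + 1),
        if q (τ.symm 0) = 0 then 0 else F τ q := by
    rw [← Equiv.sum_comp (Equiv.mulLeft (Equiv.addRight (1 : Fin (d + 1))))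
      (fun τ : Equiv.Perm (Fin (d + 1)) => ∑ q : Fin (d + 1) → Fin (M + 1),
        if q (τ.symm 0) = 0 then 0 else F τ q)]
    refine Finset.sum_congr rfl fun τ _ => ?_
    rw [← Equiv.sum_comp (Equiv.addRight (Pi.single (τ.symm (Fin.last d)) 1 :
      Fin (d + 1) → Fin (M + 1))) (fun q => if q ((Equiv.mulLeft (Equiv.addRight
        (1 : Fin (d + 1))) τ).symm 0) = 0 then 0 else F (Equiv.mulLeft (Equiv.addRight 1) τ) q)]
    refine Finset.sum_congr rfl fun q _ => ?_
    rw [rainbow_facet_last hl q τ (τ.symm (Fin.last d)) (by simp)]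
    have hs : (Equiv.mulLeft (Equiv.addRight (1 : Fin (d + 1))) τ).symm 0
        = τ.symm (Fin.last d) := by
      rw [Equiv.symm_apply_eq]
      simp
    rw [hs]
    rfl
  have hmid : ∀ k : Fin d, ∑ τ : Equiv.Perm (Fin (d + 1)), ∑ q : Fin (d + 1) → Fin (M + 1),
      rainbow d ((fun j => l (kuhnPath (fun i => (q i : ℕ)) τ j)) ∘ (k.castSucc.succ).succAbove)
        = 0 := by
    intro k
    rw [Finset.sum_comm]
    exact Finset.sum_eq_zero fun q _ => sum_inner_facets _ l k
  have hsplit : rainbowCount M (d + 1) l =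
      ∑ τ : Equiv.Perm (Fin (d + 1)), ∑ q : Fin (d + 1) → Fin (M + 1),
        if q (τ.symm 0) = 0 then F τ q else 0 := by
    have h1 : rainbowCount M (d + 1) l = ∑ j : Fin (d + 2),
        ∑ τ : Equiv.Perm (Fin (d + 1)), ∑ q : Fin (d + 1) → Fin (M + 1),
        rainbow d ((fun j => l (kuhnPath (fun i => (q i : ℕ)) τ j)) ∘ j.succAbove) := by
      rw [rainbowCount, Finset.sum_comm (s := Finset.univ (α := Fin (d + 2)))]
      refine Finset.sum_congr rfl fun τ _ => ?_
      rw [Finset.sum_comm]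
      refine Finset.sum_congr rfl fun q _ => ?_
      exact rainbow_succ fun j => hl.le _ (kuhnPath_le q τ j)
    rw [h1, Fin.sum_univ_succ, Fin.sum_univ_castSucc]
    rw [Finset.sum_eq_zero (fun k _ => hmid k), zero_add, Fin.succ_last, hlast,
      ← Finset.sum_add_distrib]
    refine Finset.sum_congr rfl fun τ _ => ?_
    rw [← Finset.sum_add_distrib]
    refine Finset.sum_congr rfl fun q _ => ?_
    split_ifs with h
    · simp [hF]
    · exact CharTwo.add_self_eq_zero _
  -- Now only facets in faces `x i = 0` are left. Unless `i = 0`, the label `d` is missing there.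
  rw [hsplit, ← Equiv.sum_comp Equiv.Perm.decomposeFin.symm, Fintype.sum_prod_type,
    Finset.sum_eq_single 0]
  · rw [rainbowCount]
    refine Finset.sum_congr rfl fun e _ => ?_
    have hs : (Equiv.Perm.decomposeFin.symm ((0 : Fin (d + 1)), e)).symm 0 = 0 := by
      rw [Equiv.symm_apply_eq]; simp
    rw [hs, ← Equiv.sum_comp (Fin.consEquiv (fun _ : Fin (d + 1) => Fin (M + 1))),
      Fintype.sum_prod_type, Finset.sum_eq_single 0]
    · refine Finset.sum_congr rfl fun q _ => ?_
      rw [if_pos (by simp [Fin.consEquiv])]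
      simp only [hF]
      congr 1
      funext j
      simp only [Function.comp_apply, Fin.succAbove_zero]
      congr 1
      funext i
      refine Fin.cases ?_ (fun i => ?_) i
      · simp [kuhnPath, Fin.consEquiv]
      · simp [kuhnPath, Fin.consEquiv]
    · intro b _ hb
      exact Finset.sum_eq_zero fun q _ => if_neg (by simpa [Fin.consEquiv] using hb)
    · simp
  · intro b _ hb
    refine Finset.sum_eq_zero fun e _ => Finset.sum_eq_zero fun q _ => ?_
    split_ifs with h
    · set τ := Equiv.Perm.decomposeFin.symm (b, e) with hτ
      have hi₀ : τ.symm 0 ≠ 0 := by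
        intro h0
        rw [Equiv.symm_apply_eq] at h0
        exact hb (by simpa [hτ] using h0.symm)
      refine rainbow_eq_zero_of_missing d le_rfl fun j hj => ?_
      have h3 := hl.zero _ (kuhnPath_le q τ j.succ) (τ.symm 0)
        (by simp [kuhnPath, show q ((Equiv.symm τ) 0) = 0 from h])
      simp only [Function.comp_apply, Fin.succAbove_zero] at hj
      have : ((τ.symm 0 : Fin (d + 1)) : ℕ) ≠ 0 := fun h => hi₀ (Fin.ext h)
      omega
    · rfl
  · simp

lemma rainbowCount_eq_one {M d : ℕ} {l : (Fin d → ℕ) → ℕ} (hl : IsSpernerLabelling M d l) :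
    rainbowCount M d l = 1 := by
  induction d with
  | zero =>
    have h0 : ∀ x, l x = 0 := fun x => Nat.le_zero.1 (hl.le x fun i => i.elim0)
    simp [rainbowCount, rainbow, h0]
  | succ d ih =>
    rw [rainbowCount_succ hl]
    have hx : ∀ x : Fin d → ℕ, (∀ i, x i ≤ M + 1) →
        ∀ i, (Fin.cons 0 x : Fin (d + 1) → ℕ) i ≤ M + 1 := by
      intro x hx i
      refine Fin.cases ?_ (fun i => ?_) i
      · simp
      · simpa using hx i
    refine ih ⟨fun x h => ?_, fun x h i hi => ?_, fun x h i hi => ?_⟩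
    · have := hl.zero _ (hx x h) 0 (by simp)
      simpa using this
    · have := hl.zero _ (hx x h) i.succ (by simpa using hi)
      rw [Fin.val_succ] at this
      omega
    · have := hl.top _ (hx x h) i.succ (by simpa using hi)
      rw [Fin.val_succ] at this
      omega

/-- **Sperner's lemma** for the cube: some simplex of the Kuhn triangulation carries all labels. -/
lemma IsSpernerLabelling.exists_rainbow {M d : ℕ} {l : (Fin d → ℕ) → ℕ}
    (hl : IsSpernerLabelling M d l) :
    ∃ (q : Fin d → Fin (M + 1)) (τ : Equiv.Perm (Fin d)), ∀ a ≤ d, ∃ j,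
      l (kuhnPath (fun i => (q i : ℕ)) τ j) = a := by
  by_contra! h
  have h1 := rainbowCount_eq_one hl
  rw [rainbowCount, Finset.sum_eq_zero] at h1
  · simp at h1
  · intro τ _
    refine Finset.sum_eq_zero fun q _ => ?_
    obtain ⟨a, ha, hj⟩ := h q τ
    exact rainbow_eq_zero_of_missing a ha hj

/-! ### Covering dimension through indexed covers -/

/-- Every finite indexed open cover of `X` can be shrunk to an open cover with the same index set such
that each point of `A` lies in at most `n + 1` of its members. For `A = univ` this is
`CoveringDimLE X n`. For a general set `A` the point is that the shrunk cover still covers `X`, so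
that such conditions can be arranged for several sets `A` one after the other. -/
def CoverOrderLEOn {X : Type} [TopologicalSpace X] (A : Set X) (n : ℕ) : Prop :=
  ∀ (ι : Type) [Finite ι] (U : ι → Set X), (∀ i, IsOpen (U i)) → ⋃ i, U i = univ →
    ∃ V : ι → Set X, (∀ i, IsOpen (V i)) ∧ ⋃ i, V i = univ ∧ (∀ i, V i ⊆ U i) ∧
      ∀ x ∈ A, {i | x ∈ V i}.encard ≤ n + 1

lemma coveringDimLE_iff {X : Type} [TopologicalSpace X] {n : ℕ} :
    CoveringDimLE X n ↔ CoverOrderLEOn (univ : Set X) n := by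
  constructor
  · intro h ι _ U hU hcov
    obtain ⟨𝒱, -, hVo, hVc, hVr, hVn⟩ := h (range U) (finite_range U)
      (by rintro _ ⟨i, rfl⟩; exact hU i) (by rw [sUnion_range, hcov])
    have hr : ∀ V : 𝒱, ∃ i, (V : Set X) ⊆ U i := by
      intro V
      obtain ⟨_, ⟨i, rfl⟩, hi⟩ := hVr V V.2
      exact ⟨i, hi⟩
    choose φ hφ using hr
    refine ⟨fun i => ⋃ V : {V : 𝒱 // φ V = i}, (V.1 : Set X),
      fun i => isOpen_iUnion fun V => hVo _ V.1.2, ?_, ?_, ?_⟩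
    · rw [eq_univ_iff_forall] at hVc ⊢
      intro x
      obtain ⟨V, hV, hx⟩ := hVc x
      exact mem_iUnion.2 ⟨φ ⟨V, hV⟩, mem_iUnion.2 ⟨⟨⟨V, hV⟩, rfl⟩, hx⟩⟩
    · intro i
      refine iUnion_subset fun V => ?_
      obtain ⟨V, rfl⟩ := V
      exact hφ V
    · intro x _
      have hsub : {i | x ∈ ⋃ V : {V : 𝒱 // φ V = i}, (V.1 : Set X)} ⊆
          φ '' (Subtype.val ⁻¹' {V ∈ 𝒱 | x ∈ V}) := by
        intro i hi
        obtain ⟨⟨V, rfl⟩, hx⟩ := mem_iUnion.1 hi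
        exact ⟨V, ⟨V.2, hx⟩, rfl⟩
      calc _ ≤ _ := encard_le_encard hsub
        _ ≤ _ := encard_image_le _ _
        _ = _ := (Subtype.val_injective.encard_image _).symm
        _ ≤ _ := encard_le_encard (image_preimage_subset _ _)
        _ ≤ _ := hVn x
  · intro h 𝒰 hfin hU hcov
    have := hfin.to_subtype
    obtain ⟨V, hVo, hVc, hVr, hVn⟩ := h 𝒰 (fun U => U) (fun U => hU U U.2)
      (by rw [← sUnion_eq_iUnion, hcov])
    refine ⟨range V, finite_range V, by rintro _ ⟨i, rfl⟩; exact hVo i,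
      by rw [sUnion_range, hVc], ?_, fun x => ?_⟩
    · rintro _ ⟨i, rfl⟩
      exact ⟨i, i.2, hVr i⟩
    · refine le_trans (encard_le_encard ?_) ((encard_image_le V {i | x ∈ V i}).trans
        (hVn x (mem_univ x)))
      rintro _ ⟨⟨i, rfl⟩, hx⟩
      exact ⟨i, hx, rfl⟩

lemma CoveringDimLE.mono {X : Type} [TopologicalSpace X] {m n : ℕ} (h : CoveringDimLE X m)
    (hmn : m ≤ n) : CoveringDimLE X n := by
  rw [coveringDimLE_iff] at h ⊢
  intro ι _ U hU hc
  obtain ⟨V, h1, h2, h3, h4⟩ := h ι U hU hc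
  refine ⟨V, h1, h2, h3, fun x hx => (h4 x hx).trans ?_⟩
  gcongr

/-- An open cover of a closed subspace extends to the whole space by adding the complement. -/
lemma CoveringDimLE.of_isClosedEmbedding {X Y : Type} [TopologicalSpace X] [TopologicalSpace Y]
    {n : ℕ} (h : CoveringDimLE Y n) {e : X → Y} (he : IsClosedEmbedding e) :
    CoveringDimLE X n := by
  rw [coveringDimLE_iff] at h ⊢
  intro ι _ U hU hc
  choose O hO hOU using fun i => he.isInducing.isOpen_iff.1 (hU i)
  obtain ⟨V, h1, h2, h3, h4⟩ := h (Option ι) (fun i => i.elim (range e)ᶜ O) (by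
      rintro (_ | i)
      · exact he.isClosed_range.isOpen_compl
      · exact hO i) (by
      rw [eq_univ_iff_forall]
      intro y
      by_cases hy : y ∈ range e
      · obtain ⟨x, rfl⟩ := hy
        obtain ⟨i, hi⟩ := mem_iUnion.1 (hc.symm ▸ mem_univ x : x ∈ ⋃ i, U i)
        refine mem_iUnion.2 ⟨some i, ?_⟩
        rw [← hOU] at hi
        exact hi
      · exact mem_iUnion.2 ⟨none, hy⟩)
  refine ⟨fun i => e ⁻¹' V (some i), fun i => (h1 _).preimage he.continuous, ?_, ?_, ?_⟩
  · rw [eq_univ_iff_forall] at h2 ⊢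
    intro x
    obtain ⟨i, hi⟩ := mem_iUnion.1 (h2 (e x))
    rcases i with _ | i
    · exact absurd (mem_range_self x) (h3 none hi)
    · exact mem_iUnion.2 ⟨i, hi⟩
  · intro i x hx
    rw [← hOU]
    exact h3 (some i) hx
  · intro x _
    refine le_trans ?_ (h4 (e x) (mem_univ _))
    rw [← (Option.some_injective ι).encard_image]
    refine encard_le_encard ?_
    rintro _ ⟨i, hi, rfl⟩
    exact hi

lemma CoverOrderLEOn.of_isClosed {X : Type} [TopologicalSpace X] {A : Set X} (hA : IsClosed A)
    {n : ℕ} (h : CoveringDimLE A n) : CoverOrderLEOn A n := by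
  rw [coveringDimLE_iff] at h
  intro ι _ U hU hc
  rw [eq_univ_iff_forall] at hc
  obtain ⟨W, h1, h2, h3, h4⟩ := h ι (fun i => Subtype.val ⁻¹' U i)
    (fun i => (hU i).preimage continuous_subtype_val) (by
      rw [eq_univ_iff_forall]
      intro x
      obtain ⟨i, hi⟩ := mem_iUnion.1 (hc x)
      exact mem_iUnion.2 ⟨i, hi⟩)
  choose O hO hOW using fun i => isOpen_induced_iff.1 (h1 i)
  have hmem : ∀ (x : A) i, (x : X) ∈ O i ↔ x ∈ W i := fun x i => by rw [← hOW]; rfl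
  refine ⟨fun i => U i ∩ (O i ∪ Aᶜ), fun i => (hU i).inter ((hO i).union hA.isOpen_compl), ?_,
    fun i => inter_subset_left, ?_⟩
  · rw [eq_univ_iff_forall] at h2 ⊢
    intro x
    by_cases hx : x ∈ A
    · obtain ⟨i, hi⟩ := mem_iUnion.1 (h2 ⟨x, hx⟩)
      exact mem_iUnion.2 ⟨i, h3 i hi, Or.inl ((hmem ⟨x, hx⟩ i).2 hi)⟩
    · obtain ⟨i, hi⟩ := mem_iUnion.1 (hc x)
      exact mem_iUnion.2 ⟨i, hi, Or.inr hx⟩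
  · intro x hx
    refine (encard_le_encard ?_).trans (h4 ⟨x, hx⟩ (mem_univ _))
    rintro i ⟨-, hi | hi⟩
    · exact (hmem ⟨x, hx⟩ i).1 hi
    · exact absurd hx hi

lemma CoverOrderLEOn.union {X : Type} [TopologicalSpace X] {A B : Set X} {n : ℕ}
    (hA : CoverOrderLEOn A n) (hB : CoverOrderLEOn B n) : CoverOrderLEOn (A ∪ B) n := by
  intro ι _ U hU hc
  obtain ⟨V, h1, h2, h3, h4⟩ := hA ι U hU hc
  obtain ⟨W, g1, g2, g3, g4⟩ := hB ι V h1 h2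
  refine ⟨W, g1, g2, fun i => (g3 i).trans (h3 i), ?_⟩
  rintro x (hx | hx)
  · exact (encard_le_encard fun i hi => g3 i hi).trans (h4 x hx)
  · exact g4 x hx

lemma CoverOrderLEOn.iUnion {X : Type} [TopologicalSpace X] {n : ℕ} {κ : Type} [Finite κ]
    {A : κ → Set X} (hA : ∀ k, CoverOrderLEOn (A k) n) : CoverOrderLEOn (⋃ k, A k) n := by
  classical
  have := Fintype.ofFinite κ
  have key : ∀ s : Finset κ, CoverOrderLEOn (⋃ k ∈ s, A k) n := by
    intro s
    induction s using Finset.induction_on with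
    | empty =>
      intro ι _ U hU hc
      exact ⟨U, hU, hc, fun _ => subset_rfl, by simp⟩
    | insert k s _ ih =>
      rw [Finset.set_biUnion_insert]
      exact (hA k).union ih
  simpa using key Finset.univ

/-- If covers can be given order at most `n + 1` on the closed set `A`, and if all closed sets disjoint
from `A` have dimension at most `n`, then so has the whole space: by the shrinking lemma, the order
is at most `n + 1` even on a neighbourhood of `A`. -/
lemma CoverOrderLEOn.coveringDimLE {X : Type} [TopologicalSpace X] [NormalSpace X]
    {A : Set X} {n : ℕ} (hA : CoverOrderLEOn A n)
    (hC : ∀ C : Set X, IsClosed C → Disjoint C A → CoveringDimLE C n) : CoveringDimLE X n := by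
  rw [coveringDimLE_iff]
  intro ι _ U hU hc
  obtain ⟨V, h1, h2, h3, h4⟩ := hA ι U hU hc
  obtain ⟨W, g2, g1, g3⟩ := exists_iUnion_eq_closure_subset h1 (fun x => toFinite _) h2
  set N : Set X := {x | {i | x ∈ closure (W i)}.encard ≤ n + 1} with hN
  have hNo : IsOpen N := by
    rw [isOpen_iff_mem_nhds]
    intro x hx
    have : ∀ᶠ y in 𝓝 x, ∀ i, x ∉ closure (W i) → y ∉ closure (W i) := by
      rw [Filter.eventually_all]
      intro i
      by_cases hi : x ∈ closure (W i)
      · simp [hi]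
      · filter_upwards [isClosed_closure.isOpen_compl.mem_nhds hi] with y hy _ using hy
    filter_upwards [this] with y hy
    refine (encard_le_encard fun i hi => ?_).trans hx
    by_contra h
    exact hy i h hi
  have hAN : A ⊆ N := fun x hx => (encard_le_encard fun i hi => g3 i hi).trans (h4 x hx)
  obtain ⟨T, t1, t2, t3, t4⟩ := CoverOrderLEOn.of_isClosed hNo.isClosed_compl
    (hC Nᶜ hNo.isClosed_compl (disjoint_compl_left_iff_subset.2 hAN)) ι W g1 g2
  refine ⟨T, t1, t2, fun i => (t3 i).trans (subset_closure.trans ((g3 i).trans (h3 i))), ?_⟩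
  intro x _
  by_cases hx : x ∈ N
  · exact (encard_le_encard fun i hi => (t3 i).trans subset_closure hi).trans hx
  · exact t4 x hx

/-- A compact subspace of a product has dimension at most `n` if the projections to finite
subproducts (times a base space `M`) have, since finite covers depend on finitely many
coordinates. -/
lemma coveringDimLE_of_finite_coordinates {X M ι Z : Type} [TopologicalSpace X] [CompactSpace X]
    [TopologicalSpace M] [TopologicalSpace Z] {n : ℕ} (b : X → M) (φ : X → ι → Z)
    (hind : IsInducing fun x => (b x, φ x))
    (h : ∀ J : Finset ι, CoveringDimLE (range fun x => (b x, fun j : J => φ x j)) n) :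
    CoveringDimLE X n := by
  classical
  rw [coveringDimLE_iff]
  intro κ _ U hU hc
  rw [eq_univ_iff_forall] at hc
  set p : ∀ J : Finset ι, X → M × (J → Z) := fun J x => (b x, fun j => φ x j) with hp
  have hbc : Continuous b := continuous_fst.comp hind.continuous
  have hφc : Continuous φ := continuous_snd.comp hind.continuous
  have hpc : ∀ J, Continuous (p J) := fun J => by fun_prop
  have hloc : ∀ x : X, ∃ (J : Finset ι) (O : Set (M × (J → Z))) (k : κ),
      IsOpen O ∧ p J x ∈ O ∧ p J ⁻¹' O ⊆ U k := by
    intro x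
    obtain ⟨k, hk⟩ := mem_iUnion.1 (hc x)
    have h1 := (hU k).mem_nhds hk
    rw [hind.nhds_eq_comap, nhds_prod_eq, Filter.mem_comap] at h1
    obtain ⟨s, hs, hsU⟩ := h1
    obtain ⟨s1, hs1, s2, hs2, hss⟩ := Filter.mem_prod_iff.1 hs
    obtain ⟨O1, hO1s, hO1, hx1⟩ := mem_nhds_iff.1 hs1
    rw [nhds_pi, Filter.mem_pi'] at hs2
    obtain ⟨J, t, ht, hts⟩ := hs2
    refine ⟨J, O1 ×ˢ (univ.pi fun j : J => interior (t j)), k,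
      hO1.prod (isOpen_set_pi finite_univ fun _ _ => isOpen_interior),
      ⟨hx1, fun j _ => mem_interior_iff_mem_nhds.2 (ht j)⟩, ?_⟩
    rintro y ⟨hy1, hy2⟩
    refine hsU (hss ⟨hO1s hy1, hts fun j hj => interior_subset (hy2 ⟨j, hj⟩ (mem_univ _))⟩)
  choose J O k hO hxO hOU using hloc
  obtain ⟨t, ht⟩ := isCompact_univ.elim_finite_subcover (fun x => p (J x) ⁻¹' O x)
    (fun x => (hO x).preimage (hpc _)) (fun x _ => mem_iUnion.2 ⟨x, hxO x⟩)
  set J' : Finset ι := t.biUnion J with hJ'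
  have hsub : ∀ x ∈ t, J x ⊆ J' := fun x hx => Finset.subset_biUnion_of_mem J hx
  set res : ∀ x : t, M × (J' → Z) → M × (J x → Z) := fun x y =>
    (y.1, fun j => y.2 ⟨j, hsub x x.2 j.2⟩) with hres
  have hresc : ∀ x, Continuous (res x) := fun x => by fun_prop
  have h' := coveringDimLE_iff.1 (h J')
  obtain ⟨V, h1, h2, h3, h4⟩ := h' t (fun x => Subtype.val ⁻¹' (res x ⁻¹' O x))
    (fun x => ((hO x).preimage (hresc x)).preimage continuous_subtype_val) (by
      rw [eq_univ_iff_forall]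
      rintro ⟨_, x, rfl⟩
      obtain ⟨y, hy, hxy⟩ := mem_iUnion₂.1 (ht (mem_univ x))
      exact mem_iUnion.2 ⟨⟨y, hy⟩, hxy⟩)
  rw [eq_univ_iff_forall] at h2
  set P : X → range (p J') := fun x => ⟨p J' x, mem_range_self x⟩ with hP
  have hPc : Continuous P := (hpc J').subtype_mk _
  refine ⟨fun i => ⋃ x : {x : t // k x = i}, P ⁻¹' V x, fun i => isOpen_iUnion fun x =>
    (h1 _).preimage hPc, ?_, ?_, ?_⟩
  · rw [eq_univ_iff_forall]
    intro x
    obtain ⟨y, hy⟩ := mem_iUnion.1 (h2 (P x))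
    exact mem_iUnion.2 ⟨k y, mem_iUnion.2 ⟨⟨y, rfl⟩, hy⟩⟩
  · intro i
    refine iUnion_subset fun y => ?_
    obtain ⟨y, rfl⟩ := y
    intro x hx
    exact hOU y (h3 y hx)
  · intro x _
    have : {i | x ∈ ⋃ y : {y : t // k y = i}, P ⁻¹' V y} ⊆
        (fun y : t => k y) '' {y | P x ∈ V y} := by
      intro i hi
      obtain ⟨⟨y, rfl⟩, hx⟩ := mem_iUnion.1 hi
      exact ⟨y, hx, rfl⟩
    exact (encard_le_encard this).trans ((encard_image_le _ _).trans (h4 _ (mem_univ _)))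

/-! ### The covering dimension of cubes -/

/-- The open star of the grid point `v` in the Kuhn triangulation of mesh `1 / N`. The vertices of the
simplex carrying `x` are the points `⌊N x + (t, …, t)⌋` for generic `t`, and the strict
inequalities make the star open. -/
def kuhnStar {ι : Type} (N : ℕ) (v : ι → Fin (N + 1)) : Set (ι → unitInterval) :=
  {x | ∃ t ∈ Ioo (0 : ℝ) 1, ∀ i, ((v i : ℕ) : ℝ) < N * x i + t ∧
    (N * x i + t : ℝ) < (v i : ℕ) + 1}

lemma isOpen_kuhnStar {ι : Type} [Finite ι] (N : ℕ) (v : ι → Fin (N + 1)) :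
    IsOpen (kuhnStar N v) := by
  have : kuhnStar N v = ⋃ t ∈ Ioo (0 : ℝ) 1, ⋂ i,
      {x : ι → unitInterval | ((v i : ℕ) : ℝ) < N * x i + t} ∩
        {x | (N * x i + t : ℝ) < (v i : ℕ) + 1} := by
    ext x
    simp [kuhnStar]
  rw [this]
  refine isOpen_biUnion fun t _ => isOpen_iInter_of_finite fun i => IsOpen.inter ?_ ?_
  · exact isOpen_lt continuous_const (by fun_prop)
  · exact isOpen_lt (by fun_prop) continuous_const

lemma exists_mem_kuhnStar {ι : Type} [Finite ι] (N : ℕ) (x : ι → unitInterval) :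
    ∃ v, x ∈ kuhnStar N v := by
  -- all but finitely many `t` avoid that a coordinate of `N x + (t, …, t)` is an integer
  have hfin : (range fun i => 1 - Int.fract (N * x i : ℝ)).Finite := finite_range _
  obtain ⟨t, ht, htn⟩ := ((Ioo_infinite (zero_lt_one' ℝ)).sdiff hfin).nonempty
  have hfl : ∀ i, (⌊(N * x i + t : ℝ)⌋₊ : ℝ) ≤ N * x i + t ∧
      (N * x i + t : ℝ) < ⌊(N * x i + t : ℝ)⌋₊ + 1 := by
    intro i
    have := (x i).2.1
    have := ht.1
    exact ⟨Nat.floor_le (by positivity), Nat.lt_floor_add_one _⟩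
  refine ⟨fun i => ⟨⌊(N * x i + t : ℝ)⌋₊, ?_⟩, t, ht, fun i => ⟨(hfl i).1.lt_of_ne ?_, (hfl i).2⟩⟩
  · have h1 : (N * x i : ℝ) ≤ N := mul_le_of_le_one_right (by positivity) (x i).2.2
    have h2 : (⌊(N * x i + t : ℝ)⌋₊ : ℝ) < N + 1 := by linarith [(hfl i).1, ht.2]
    exact_mod_cast h2
  · intro h
    refine htn ⟨i, ?_⟩
    have h3 : Int.fract (N * x i : ℝ) = 1 - t := by
      rw [Int.fract_eq_iff]
      refine ⟨by linarith [ht.2], by linarith [ht.1], ((⌊(N * x i + t : ℝ)⌋₊ : ℤ) - 1), ?_⟩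
      push_cast
      linarith
    simp only [h3]
    ring

/-- The vertices whose stars contain `x` form a chain in the coordinatewise order along which the sum
of the coordinates increases, and their coordinates are `⌊N x i⌋` or `⌊N x i⌋ + 1`. -/
lemma encard_kuhnStar_le {ι : Type} [Fintype ι] (N : ℕ) (x : ι → unitInterval) :
    {v | x ∈ kuhnStar N v}.encard ≤ Fintype.card ι + 1 := by
  set s : ℕ := ∑ i, ⌊(N * x i : ℝ)⌋₊ with hs
  have hmono : ∀ v w : ι → Fin (N + 1), ∀ t u : ℝ, t ≤ u →
      (∀ i, ((v i : ℕ) : ℝ) < N * x i + t ∧ (N * x i + t : ℝ) < (v i : ℕ) + 1) →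
      (∀ i, ((w i : ℕ) : ℝ) < N * x i + u ∧ (N * x i + u : ℝ) < (w i : ℕ) + 1) →
      ∑ i, (v i : ℕ) = ∑ i, (w i : ℕ) → v = w := by
    intro v w t u htu hv hw hvw
    have hle : ∀ i ∈ Finset.univ, (v i : ℕ) ≤ w i := by
      intro i _
      have : ((v i : ℕ) : ℝ) < (w i : ℕ) + 1 := by linarith [(hv i).1, (hw i).2]
      have : (v i : ℕ) < (w i : ℕ) + 1 := by exact_mod_cast this
      omega
    funext i
    exact Fin.ext ((Finset.sum_eq_sum_iff_of_le hle).1 hvw i (Finset.mem_univ i))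
  have h1 : {v | x ∈ kuhnStar N v}.encard ≤
      ((Finset.Icc s (s + Fintype.card ι) : Finset ℕ) : Set ℕ).encard := by
    refine encard_le_encard_of_injOn (f := fun v => ∑ i, (v i : ℕ)) ?_ ?_
    · rintro v ⟨t, ht, hv⟩
      have hb : ∀ i, ⌊(N * x i : ℝ)⌋₊ ≤ v i ∧ (v i : ℕ) ≤ ⌊(N * x i : ℝ)⌋₊ + 1 := by
        intro i
        have h0 : (0 : ℝ) ≤ N * x i := mul_nonneg (by positivity) (x i).2.1
        have e1 := Nat.floor_le h0
        have e2 := Nat.lt_floor_add_one (N * x i : ℝ)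
        have e3 : (⌊(N * x i : ℝ)⌋₊ : ℝ) < (v i : ℕ) + 1 := by linarith [(hv i).2, ht.1]
        have e4 : ((v i : ℕ) : ℝ) < ⌊(N * x i : ℝ)⌋₊ + 1 + 1 := by linarith [(hv i).1, ht.2]
        have e3' : ⌊(N * x i : ℝ)⌋₊ < (v i : ℕ) + 1 := by exact_mod_cast e3
        have e4' : (v i : ℕ) < ⌊(N * x i : ℝ)⌋₊ + 1 + 1 := by exact_mod_cast e4
        omega
      simp only [Finset.coe_Icc, mem_Icc]
      refine ⟨Finset.sum_le_sum fun i _ => (hb i).1,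
        (Finset.sum_le_sum fun i _ => (hb i).2).trans (le_of_eq ?_)⟩
      rw [Finset.sum_add_distrib]
      simp [hs]
    · rintro v ⟨t, ht, hv⟩ w ⟨u, hu, hw⟩ hvw
      rcases le_total t u with h | h
      · exact hmono v w t u h hv hw hvw
      · exact (hmono w v u t h hw hv hvw.symm).symm
  refine h1.trans (le_of_eq ?_)
  rw [encard_coe_eq_coe_finsetCard, Nat.card_Icc, show s + Fintype.card ι + 1 - s
    = Fintype.card ι + 1 by omega]
  push_cast
  rfl

lemma coveringDimLE_cube (ι : Type) [Fintype ι] :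
    CoveringDimLE (ι → unitInterval) (Fintype.card ι) := by
  rw [coveringDimLE_iff]
  intro κ _ U hU hc
  obtain ⟨δ, hδ, hball⟩ := lebesgue_number_lemma_of_metric isCompact_univ hU hc.ge
  -- stars of mesh `1 / N` have diameter at most `2 / N` in the maximum metric
  obtain ⟨N, hN⟩ := exists_nat_gt (2 / δ)
  have hN0 : (0 : ℝ) < N := lt_trans (by positivity) hN
  have hk : ∀ v : ι → Fin (N + 1), ∃ k, kuhnStar N v ⊆ U k := by
    intro v
    rcases (kuhnStar N v).eq_empty_or_nonempty with h | ⟨c, t, ht, hc⟩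
    · obtain ⟨k, -⟩ := hball 0 (mem_univ _)
      exact ⟨k, by simp [h]⟩
    · obtain ⟨k, hk⟩ := hball c (mem_univ _)
      refine ⟨k, fun x ⟨u, hu, hx⟩ => hk ?_⟩
      rw [Metric.mem_ball, dist_pi_lt_iff hδ]
      intro i
      have h2 : 2 < δ * N := by rwa [div_lt_iff₀ hδ, mul_comm] at hN
      rw [Subtype.dist_eq, Real.dist_eq, ← mul_lt_mul_iff_left₀ hN0]
      refine lt_of_le_of_lt ?_ h2
      calc |(x i : ℝ) - c i| * N = |(N * x i - N * c i : ℝ)| := by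
            rw [← mul_sub, abs_mul, abs_of_pos hN0, mul_comm]
        _ ≤ 2 := by
            rw [abs_le]
            constructor <;> linarith [(hx i).1, (hx i).2, (hc i).1, (hc i).2, ht.1, ht.2, hu.1, hu.2]
  choose k hk using hk
  refine ⟨fun i => ⋃ v : {v // k v = i}, kuhnStar N v.1,
    fun i => isOpen_iUnion fun v => isOpen_kuhnStar N v.1, ?_, ?_, ?_⟩
  · rw [eq_univ_iff_forall]
    intro x
    obtain ⟨v, hv⟩ := exists_mem_kuhnStar N x
    exact mem_iUnion.2 ⟨k v, mem_iUnion.2 ⟨⟨v, rfl⟩, hv⟩⟩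
  · intro i
    refine iUnion_subset fun v => ?_
    obtain ⟨v, rfl⟩ := v
    exact hk v
  · intro x _
    have : {i | x ∈ ⋃ v : {v // k v = i}, kuhnStar N v.1} ⊆ k '' {v | x ∈ kuhnStar N v} := by
      intro i hi
      obtain ⟨⟨v, rfl⟩, hx⟩ := mem_iUnion.1 hi
      exact ⟨v, hx, rfl⟩
    exact (encard_le_encard this).trans ((encard_image_le _ _).trans (encard_kuhnStar_le N x))

/-- **Lebesgue's covering theorem.** In a cover refining one whose members never meet two opposite
faces, the members get labels according to the faces that they meet. Sperner's lemma on a grid finer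
than a Lebesgue number of the cover gives a point that lies in members with all `m + 2` labels. -/
lemma not_coveringDimLE_cube (m : ℕ) : ¬ CoveringDimLE (Fin (m + 1) → unitInterval) m := by
  rw [coveringDimLE_iff]
  intro h
  set d := m + 1 with hd
  obtain ⟨V, hVo, hVc, hVU, hVn⟩ := h (Fin d → Bool)
    (fun s => {x | ∀ i, if s i then (1 / 3 : ℝ) < x i else (x i : ℝ) < 2 / 3}) (by
      intro s
      rw [ofPred_forall]
      refine isOpen_iInter_of_finite fun i => ?_
      cases s i
      · simpa using isOpen_lt (by fun_prop) continuous_const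
      · simpa using isOpen_lt continuous_const (by fun_prop)) (by
      rw [eq_univ_iff_forall]
      intro x
      refine mem_iUnion.2 ⟨fun i => decide ((1 / 3 : ℝ) < x i), fun i => ?_⟩
      by_cases hx : (1 / 3 : ℝ) < x i
      · rw [if_pos (decide_eq_true hx)]
        exact hx
      · rw [if_neg (by simpa using hx)]
        linarith)
  obtain ⟨δ, hδ, hball⟩ := lebesgue_number_lemma_of_metric isCompact_univ hVo hVc.ge
  obtain ⟨M, hM⟩ := exists_nat_one_div_lt hδ
  set z : (Fin d → ℕ) → (Fin d → unitInterval) := fun x i =>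
    projIcc (0 : ℝ) 1 zero_le_one ((x i : ℝ) / (M + 1)) with hz
  choose s hs using fun x => hball (z x) (mem_univ _)
  -- the label of `V s` is the least `k` such that `V s` meets the face `x (d - 1 - k) = 0`, or `d`
  set K : (Fin d → Bool) → Set ℕ := fun s =>
    {k | ∃ i : Fin d, i + k + 1 = d ∧ ∃ y ∈ V s, y i = 0} with hK
  set lab : (Fin d → Bool) → ℕ := fun s => sInf (insert d (K s)) with hlab
  have hle : ∀ s, ∀ k ∈ insert d (K s), lab s ≤ k := fun s k hk => Nat.sInf_le hk
  have hmem : ∀ s, lab s ∈ insert d (K s) := fun s => Nat.sInf_mem (insert_nonempty _ _)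
  have hzV : ∀ x, z x ∈ V (s x) := fun x => hs x (Metric.mem_ball_self hδ)
  have hsp : IsSpernerLabelling M d fun x => lab (s x) := by
    refine ⟨fun x _ => hle _ _ (mem_insert _ _), fun x _ i hi => ?_, fun x _ i hi hl => ?_⟩
    · have : lab (s x) ≤ d - 1 - i := by
        refine hle _ _ (mem_insert_of_mem _ ⟨i, by omega, z x, hzV x, ?_⟩)
        simp [hz, hi]
      omega
    · rcases hmem (s x) with h | ⟨i', hi', y, hy, hy0⟩
      · omega
      obtain rfl : i' = i := Fin.ext (by omega)
      have hz1 : z x i' = 1 := by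
        simp only [hz, hi]
        push_cast
        rw [div_self (by positivity), projIcc_right]
        rfl
      have h1 := hVU _ hy i'
      have h2 := hVU _ (hzV x) i'
      rw [hy0] at h1
      rw [hz1] at h2
      split_ifs at h1 h2
      · norm_num at h1
      · norm_num at h2
  obtain ⟨q, τ, hrain⟩ := hsp.exists_rainbow
  set P := fun j => kuhnPath (fun i => (q i : ℕ)) τ j with hP
  -- the vertices of the rainbow simplex are within `δ` of the first one
  have hclose : ∀ j, z (P 0) ∈ V (s (P j)) := by
    intro j
    refine hs _ ?_
    rw [Metric.mem_ball, dist_pi_lt_iff hδ]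
    intro i
    refine lt_of_le_of_lt ?_ hM
    refine ((LipschitzWith.projIcc zero_le_one).dist_le_mul _ _).trans ?_
    rw [Real.dist_eq, ← sub_div, abs_div, abs_of_pos (by positivity : (0 : ℝ) < M + 1),
      NNReal.coe_one, one_mul]
    gcongr
    simp only [hP, kuhnPath]
    push_cast
    split_ifs <;> simp
  choose! j hj using hrain
  have hinj : InjOn (fun a => s (P (j a))) (Finset.range (d + 1) : Set ℕ) := by
    intro a ha b hb hab
    rw [← hj a (by simpa [Nat.lt_succ_iff] using ha), ← hj b (by simpa [Nat.lt_succ_iff] using hb)]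
    exact congrArg lab hab
  have h1 := (encard_le_encard_of_injOn (t := {i | z (P 0) ∈ V i}) (fun a _ => hclose (j a))
    hinj).trans (hVn (z (P 0)) (mem_univ _))
  rw [encard_coe_eq_coe_finsetCard, Finset.card_range] at h1
  have h2 : d + 1 ≤ m + 1 := by exact_mod_cast h1
  omega

/-- A space containing the cube `[0,1]^n` has dimension at least `n`. -/
lemma le_of_coveringDimLE_of_isEmbedding {X : Type} [TopologicalSpace X] [T2Space X] {n : ℕ∞}
    {g : Cube n → X} (hg : IsEmbedding g) {m : ℕ} (h : CoveringDimLE X m) : n ≤ m := by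
  by_contra! hmn
  have hgc : IsClosedEmbedding g := ⟨hg, (isCompact_range hg.continuous).isClosed⟩
  have h1 := h.of_isClosedEmbedding hgc
  have hlt : ∀ i : Fin (m + 1), ((i : ℕ) : ℕ∞) < n := fun i =>
    lt_of_le_of_lt (by exact_mod_cast Nat.lt_succ_iff.1 i.2) hmn
  set e : (Fin (m + 1) → unitInterval) → Cube n := fun x i =>
    if hi : i.1 < m + 1 then x ⟨i, hi⟩ else 0 with he
  have hec : Continuous e := by
    refine continuous_pi fun i => ?_
    by_cases hi : i.1 < m + 1
    · simp only [he, hi, dif_pos]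
      exact continuous_apply _
    · simp only [he, hi, dif_neg, not_false_eq_true]
      exact continuous_const
  have hei : Function.Injective e := by
    intro x y hxy
    funext i
    have := congrFun hxy ⟨i, hlt i⟩
    simpa [he, Nat.le_of_lt_succ i.2] using this
  exact not_coveringDimLE_cube m (h1.of_isClosedEmbedding (hec.isClosedEmbedding hei))

lemma coveringDimLE_Cube (n : ℕ) : CoveringDimLE (Cube n) n := by
  have hfin : Finite {i : ℕ // (i : ℕ∞) < n} := by
    have h : {i : ℕ | (i : ℕ∞) < n} = Iio n := by ext i; simp
    exact (h ▸ finite_Iio n : {i : ℕ | (i : ℕ∞) < n}.Finite).to_subtype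
  have := Fintype.ofFinite {i : ℕ // (i : ℕ∞) < n}
  have hcard : Fintype.card {i : ℕ // (i : ℕ∞) < n} = n := by
    rw [Fintype.card_of_subtype (Finset.range n) (by simp)]
    simp
  simpa [hcard] using coveringDimLE_cube {i : ℕ // (i : ℕ∞) < n}

lemma coveringDimLE_unitInterval : CoveringDimLE unitInterval 1 := by
  have h := coveringDimLE_cube Unit
  rw [Fintype.card_unit] at h
  exact h.of_isClosedEmbedding (Homeomorph.funUnique Unit unitInterval).symm.isClosedEmbedding

/-- The covering dimension is `n` as soon as there is a copy of `[0,1]^n` and, for finite `n`, the upper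
bound holds. -/
lemma coveringDim_eq {X : Type} [TopologicalSpace X] [T2Space X] {n : ℕ∞}
    {g : Cube n → X} (hg : IsEmbedding g) (h : ∀ m : ℕ, n = m → CoveringDimLE X m) :
    coveringDim X = (n : WithBot ℕ∞) := by
  have hne : ¬ IsEmpty X := fun hX => hX.elim (g 0)
  rw [coveringDim, if_neg hne]
  congr 1
  refine le_antisymm ?_ (le_iInf fun m => le_of_coveringDimLE_of_isEmbedding hg m.2)
  induction n using ENat.recTopCoe with
  | top => exact le_top
  | coe m => exact iInf_le (fun k : {k : ℕ // CoveringDimLE X k} => ((k : ℕ) : ℕ∞)) ⟨m, h m rfl⟩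

/-! ### Splitting points and splitting functions for all uncountable closed sets -/

/-- Distinct representatives of sets that are not smaller than their index set, by transfinite
recursion along a well-order whose initial segments are smaller than the index set. -/
lemma exists_injective_choice {ι α : Type} (D : ι → Set α)
    (h : ∀ i, Cardinal.mk ι ≤ Cardinal.mk (D i)) :
    ∃ r : ι → α, Function.Injective r ∧ ∀ i, r i ∈ D i := by
  obtain ⟨_, _, hord⟩ := Cardinal.exists_ord_eq_type_lt ι
  have hstep : ∀ (i : ι) (p : ∀ j, j < i → α), ∃ a ∈ D i, ∀ j (hj : j < i), p j hj ≠ a := by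
    intro i p
    by_contra! hcon
    have hsub : D i ⊆ range fun j : Iio i => p j j.2 := by
      intro a ha
      obtain ⟨j, hj, rfl⟩ := hcon a ha
      exact ⟨⟨j, hj⟩, rfl⟩
    exact absurd (((h i).trans (Cardinal.mk_le_mk_of_subset hsub)).trans Cardinal.mk_range_le)
      (not_le.2 (Cardinal.mk_Iio_lt i hord))
  choose c hcD hcn using hstep
  set r : ι → α := WellFoundedLT.fix c with hr
  have hfix : ∀ i, r i = c i fun j _ => r j := fun i => WellFoundedLT.fix_eq c i
  have hlt : ∀ i j, i < j → r i ≠ r j := by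
    intro i j hij
    rw [hfix j]
    exact hcn j (fun j _ => r j) i hij
  refine ⟨r, fun i j hij => ?_, fun i => ?_⟩
  · rcases lt_trichotomy i j with hlt' | rfl | hlt'
    · exact absurd hij (hlt i j hlt')
    · rfl
    · exact absurd hij.symm (hlt j i hlt')
  · rw [hfix]
    exact hcD _ _

/-- If `F` accumulates at `r`, there is a continuous map on the complement of `r` that maps the part of
`F` in each punctured neighbourhood of `r` onto a dense set: its values on a sequence in `F` that
converges to `r` can be prescribed by Tietze's theorem, so that each point of a countable dense set
is taken infinitely often. -/
lemma exists_splitting_function {M Y : Type} [MetricSpace M] [LocallyCompactSpace M]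
    [TopologicalSpace Y] [TietzeExtension.{0, 0} Y] [TopologicalSpace.SeparableSpace Y] [Nonempty Y]
    {F : Set M} {r : M} (hr : AccPt r (Filter.principal F)) :
    ∃ f : {x : M // x ≠ r} → Y, Continuous f ∧
      ∀ U : Set M, IsOpen U → r ∈ U → Dense (f '' {x | (x : M) ∈ U ∩ F}) := by
  obtain ⟨u, huP, hu⟩ := exists_seq_of_forall_finset_exists
    (fun x : {x : M // x ≠ r} => (x : M) ∈ F)
    (fun x y => dist (y : M) r < dist (x : M) r / 2) (by
      intro s _
      have h1 : ∀ᶠ y in 𝓝 r, ∀ x ∈ s, dist y r < dist (x : M) r / 2 := by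
        rw [Filter.eventually_all_finset]
        intro x _
        exact Metric.ball_mem_nhds r (half_pos (dist_pos.2 x.2))
      obtain ⟨y, ⟨hy, hyF⟩, hyr⟩ := accPt_iff_nhds.1 hr _ h1
      exact ⟨⟨y, hyr⟩, hyF, hy⟩)
  have hanti : StrictAnti fun n => dist (u n : M) r := by
    refine strictAnti_nat_of_succ_lt fun n => (hu n (n + 1) n.lt_succ_self).trans ?_
    exact half_lt_self (dist_pos.2 (u n).2)
  have hinj : Function.Injective u := by
    intro m n hmn
    exact hanti.injective (by simp only [hmn])
  have hgeom : ∀ n, dist (u n : M) r ≤ dist (u 0 : M) r * (1 / 2) ^ n := by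
    intro n
    induction n with
    | zero => simp
    | succ n ih =>
      have := hu n (n + 1) n.lt_succ_self
      rw [pow_succ]
      linarith
  have hlim : Filter.Tendsto (fun n => (u n : M)) Filter.atTop (𝓝 r) := by
    rw [tendsto_iff_dist_tendsto_zero]
    refine squeeze_zero (fun _ => dist_nonneg) hgeom ?_
    simpa using (tendsto_pow_atTop_nhds_zero_of_lt_one (by norm_num : (0 : ℝ) ≤ 1 / 2)
      (by norm_num)).const_mul (dist (u 0 : M) r)
  have : LocallyCompactSpace {x : M // x ≠ r} :=
    (isOpen_ne (x := r)).isOpenEmbedding_subtypeVal.locallyCompactSpace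
  have huc : IsClosedEmbedding u := by
    refine IsClosedEmbedding.of_continuous_injective_isClosedMap continuous_of_discreteTopology hinj
      (isProperMap_iff_tendsto_cocompact.2 ⟨continuous_of_discreteTopology, ?_⟩).isClosedMap
    rw [Filter.tendsto_def]
    intro s hs
    obtain ⟨C, hC, hCs⟩ := Filter.mem_cocompact.1 hs
    have hCr : r ∉ Subtype.val '' C := by
      rintro ⟨x, -, hx⟩
      exact x.2 hx
    have hev := hlim.eventually
      ((hC.image continuous_subtype_val).isClosed.isOpen_compl.mem_nhds hCr)
    rw [Filter.cocompact_eq_cofinite, Nat.cofinite_eq_atTop]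
    filter_upwards [hev] with n hn
    exact hCs fun h => hn ⟨_, h, rfl⟩
  obtain ⟨f, hf⟩ := ContinuousMap.exists_extension huc
    (⟨fun n => TopologicalSpace.denseSeq Y n.unpair.1, continuous_of_discreteTopology⟩ : C(ℕ, Y))
  refine ⟨f, f.continuous, fun U hU hrU => ?_⟩
  refine (TopologicalSpace.denseRange_denseSeq Y).mono ?_
  rintro _ ⟨k, rfl⟩
  obtain ⟨N, hN⟩ := Filter.eventually_atTop.1 (hlim.eventually (hU.mem_nhds hrU))
  refine ⟨u (Nat.pair k N), ⟨hN _ (Nat.right_le_pair k N), huP _⟩, ?_⟩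
  have := congrArg (fun g => g (Nat.pair k N)) hf
  simpa using this

/-- The uncountable closed subsets of `[0,1]`. -/
abbrev UncountableClosed : Type := {F : Set unitInterval // IsClosed F ∧ ¬ F.Countable}

lemma mk_uncountableClosed_le : Cardinal.mk UncountableClosed ≤ Cardinal.continuum := by
  have hinj : Function.Injective fun F : UncountableClosed =>
      {U : TopologicalSpace.countableBasis unitInterval | Disjoint (U : Set unitInterval) F.1} := by
    have hsub : ∀ F G : UncountableClosed,
        {U : TopologicalSpace.countableBasis unitInterval | Disjoint (U : Set unitInterval) F.1} =
        {U : TopologicalSpace.countableBasis unitInterval | Disjoint (U : Set unitInterval) G.1} →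
        G.1 ⊆ F.1 := by
      intro F G h x hx
      by_contra hxF
      obtain ⟨U, hU, hxU, hUF⟩ := (TopologicalSpace.isBasis_countableBasis
        unitInterval).mem_nhds_iff.1
        (F.2.1.isOpen_compl.mem_nhds hxF)
      have h1 : (⟨U, hU⟩ : TopologicalSpace.countableBasis unitInterval) ∈
        {U : TopologicalSpace.countableBasis unitInterval | Disjoint (U : Set unitInterval) F.1} :=
        disjoint_left.2 fun y hy => hUF hy
      rw [h] at h1
      exact disjoint_left.1 h1 hxU hx
    intro F G h
    exact Subtype.ext (subset_antisymm (hsub G F h.symm) (hsub F G h))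
  refine (Cardinal.mk_le_of_injective hinj).trans ?_
  rw [Cardinal.mk_set, ← Cardinal.two_power_aleph0]
  exact Cardinal.power_le_power_left two_ne_zero
    (Cardinal.mk_le_aleph0_iff.2 (TopologicalSpace.countable_countableBasis _).to_subtype)

instance UncountableClosed.uncountable : Uncountable UncountableClosed := by
  have hF : ∀ t : Ioo (0 : ℝ) 1, IsClosed {x : unitInterval | (x : ℝ) ≤ t} ∧
      ¬ {x : unitInterval | (x : ℝ) ≤ t}.Countable := by
    intro t
    refine ⟨isClosed_le continuous_subtype_val continuous_const, fun h => ?_⟩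
    have h1 : (Icc (0 : ℝ) t).Countable := by
      refine (h.image Subtype.val).mono ?_
      rintro x ⟨hx0, hxt⟩
      exact ⟨⟨x, hx0, hxt.trans t.2.2.le⟩, hxt, rfl⟩
    exact (Cardinal.Real.Icc_countable_iff.1 h1).not_gt t.2.1
  have hle : ∀ s t : Ioo (0 : ℝ) 1, {x : unitInterval | (x : ℝ) ≤ s} =
      {x : unitInterval | (x : ℝ) ≤ t} → (s : ℝ) ≤ t := by
    intro s t h
    have h1 : (⟨s, s.2.1.le, s.2.2.le⟩ : unitInterval) ∈ {x : unitInterval | (x : ℝ) ≤ s} :=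
      le_refl (s : ℝ)
    rwa [h] at h1
  have hinj : Function.Injective fun t : Ioo (0 : ℝ) 1 =>
      (⟨{x : unitInterval | (x : ℝ) ≤ t}, hF t⟩ : UncountableClosed) := by
    intro s t h
    have h1 := congrArg Subtype.val h
    exact Subtype.ext (le_antisymm (hle s t h1) (hle t s h1.symm))
  have : Uncountable (Ioo (0 : ℝ) 1) := by
    rw [← Cardinal.aleph0_lt_mk_iff, Cardinal.mk_Ioo_real zero_lt_one]
    exact Cardinal.aleph0_lt_continuum
  exact hinj.uncountable

/-- There is a splitting family indexed by the uncountable closed sets `F` of `[0,1]` such that the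
splitting point of `F` is in `F`, and the splitting function for `F` has dense image already
on the part of `F` in each punctured neighbourhood of the splitting point. -/
lemma exists_splittingFamily (Y : Type) [TopologicalSpace Y] [TietzeExtension.{0, 0} Y]
    [TopologicalSpace.SeparableSpace Y] [Nonempty Y] :
    ∃ S : SplittingFamily unitInterval (fun _ : UncountableClosed => Y), ∀ F : UncountableClosed,
      S.r F ∈ F.1 ∧ ∀ U : Set unitInterval, IsOpen U → S.r F ∈ U →
        Dense (S.f F '' {x | (x : unitInterval) ∈ U ∩ F.1}) := by
  have hperf : ∀ F : UncountableClosed, ∃ D : Set unitInterval, Perfect D ∧ D.Nonempty ∧ D ⊆ F.1 :=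
    fun F => exists_perfect_nonempty_of_isClosed_of_not_countable F.2.1 F.2.2
  choose D hDp hDn hDF using hperf
  obtain ⟨r, hr, hrD⟩ := exists_injective_choice D (by
    intro F
    refine mk_uncountableClosed_le.trans ?_
    obtain ⟨g, hgD, -, hg⟩ := (hDp F).exists_nat_bool_injection (hDn F)
    calc Cardinal.continuum = Cardinal.mk (ℕ → Bool) := by simp
      _ = Cardinal.mk (range g) := (Cardinal.mk_range_eq g hg).symm
      _ ≤ _ := Cardinal.mk_le_mk_of_subset hgD)
  have hacc : ∀ F, AccPt (r F) (Filter.principal F.1) := fun F =>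
    ((hDp F).acc (r F) (hrD F)).mono (Filter.principal_mono.2 (hDF F))
  choose f hfc hfd using fun F => exists_splitting_function (Y := Y) (hacc F)
  refine ⟨⟨r, hr, f, hfc, fun F U hU hrU => (hfd F U hU hrU).mono ?_⟩,
    fun F => ⟨hDF F (hrD F), hfd F⟩⟩
  exact image_mono fun x hx => hx.1

/-! ### Split spaces -/

namespace SplittingFamily

variable {M ι Y : Type} [TopologicalSpace M] [TopologicalSpace Y]

/-- The point over the splitting point `r ξ` whose `ξ`-th coordinate is `t`. -/
noncomputable def fibrePoint (S : SplittingFamily M (fun _ : ι => Y)) (ξ : ι) (t : Y) :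
    M × (ι → Y) := by
  classical
  exact (S.r ξ, fun η => if h : S.r ξ ≠ S.r η then S.f η ⟨S.r ξ, h⟩ else t)

lemma fibrePoint_mem (S : SplittingFamily M (fun _ : ι => Y)) (ξ : ι) (t : Y) :
    S.fibrePoint ξ t ∈ S.split := by
  intro η h
  have h' : S.r ξ ≠ S.r η := h
  simp only [fibrePoint, dif_pos h']

lemma fibrePoint_self (S : SplittingFamily M (fun _ : ι => Y)) (ξ : ι) (t : Y) :
    (S.fibrePoint ξ t).2 ξ = t := by
  simp [fibrePoint]

lemma fibrePoint_of_ne (S : SplittingFamily M (fun _ : ι => Y)) {ξ η : ι} (h : ξ ≠ η) (t s : Y) :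
    (S.fibrePoint ξ t).2 η = (S.fibrePoint ξ s).2 η := by
  have h' : S.r ξ ≠ S.r η := S.r_injective.ne h
  simp [fibrePoint, h']

lemma eq_fibrePoint (S : SplittingFamily M (fun _ : ι => Y)) {p : M × (ι → Y)} (hp : p ∈ S.split)
    {ξ : ι} (h : p.1 = S.r ξ) : p = S.fibrePoint ξ (p.2 ξ) := by
  obtain ⟨m, x⟩ := p
  obtain rfl : m = S.r ξ := h
  refine Prod.ext rfl (funext fun η => ?_)
  rcases eq_or_ne η ξ with rfl | hη
  · rw [fibrePoint_self]
  · have h' : S.r ξ ≠ S.r η := S.r_injective.ne hη.symm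
    simp only [fibrePoint, dif_pos h']
    exact hp η h'

lemma continuous_fibrePoint (S : SplittingFamily M (fun _ : ι => Y)) (ξ : ι) :
    Continuous (S.fibrePoint ξ) := by
  refine continuous_const.prodMk (continuous_pi fun η => ?_)
  by_cases h : S.r ξ ≠ S.r η
  · simp only [dif_pos h]
    exact continuous_const
  · simp only [dif_neg h]
    exact continuous_id

lemma isClosed_split [T2Space M] [T2Space Y] (S : SplittingFamily M (fun _ : ι => Y)) :
    IsClosed S.split := by
  have hsplit : S.splitᶜ = ⋃ ξ, Subtype.val ''
      {p : {p : M × (ι → Y) // p.1 ≠ S.r ξ} | p.1.2 ξ ≠ S.f ξ ⟨p.1.1, p.2⟩} := by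
    ext p
    simp only [split, mem_compl_iff, mem_ofPred_eq, mem_iUnion, mem_image, Subtype.exists,
      exists_and_right, exists_eq_right, not_forall]
  rw [← isOpen_compl_iff, hsplit]
  refine isOpen_iUnion fun ξ => ?_
  have ho : IsOpen {p : M × (ι → Y) | p.1 ≠ S.r ξ} := isOpen_ne.preimage continuous_fst
  refine ho.isOpenEmbedding_subtypeVal.isOpenMap _ (isOpen_ne_fun ?_ ?_)
  · exact (continuous_apply ξ).comp (continuous_snd.comp continuous_subtype_val)
  · exact (S.continuous_f ξ).comp ((continuous_fst.comp continuous_subtype_val).subtype_mk _)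

lemma compactSpace_split [CompactSpace M] [T2Space M] [CompactSpace Y] [T2Space Y]
    (S : SplittingFamily M (fun _ : ι => Y)) : CompactSpace S.split :=
  isCompact_iff_compactSpace.1 S.isClosed_split.isCompact

/-- If `f ξ` has dense image on the part of `F` in each punctured neighbourhood of `r ξ`, then a compact
subset of the split space that lies over `F` contains the whole fibre over `r ξ`. -/
lemma fibrePoint_mem_of_isCompact [T2Space M] [T2Space Y] (S : SplittingFamily M (fun _ : ι => Y))
    {L : Set S.split} (hL : IsCompact L) {ξ : ι}
    (hd : ∀ U : Set M, IsOpen U → S.r ξ ∈ U →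
      Dense (S.f ξ '' {x | (x : M) ∈ U ∩ (fun p : S.split => p.1.1) '' L})) (t : Y) :
    (⟨S.fibrePoint ξ t, S.fibrePoint_mem ξ t⟩ : S.split) ∈ L := by
  set T : Set (M × Y) := (fun p : S.split => (p.1.1, p.1.2 ξ)) '' L with hT
  have hTc : IsClosed T := by
    refine (hL.image ?_).isClosed
    have h1 : Continuous fun p : S.split => p.1.2 := continuous_snd.comp continuous_subtype_val
    exact (continuous_fst.comp continuous_subtype_val).prodMk ((continuous_apply ξ).comp h1)
  have hmem : (S.r ξ, t) ∈ T := by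
    rw [← hTc.closure_eq, mem_closure_iff_nhds]
    intro W hW
    obtain ⟨U, V, hU, hrU, hV, htV, hUV⟩ := mem_nhds_prod_iff'.1 hW
    obtain ⟨_, hyV, x, ⟨hxU, p, hpL, hpx⟩, rfl⟩ := (hd U hU hrU).inter_open_nonempty V hV ⟨t, htV⟩
    refine ⟨(p.1.1, p.1.2 ξ), hUV ⟨?_, ?_⟩, p, hpL, rfl⟩
    · simp only at hpx
      rw [hpx]
      exact hxU
    · simp only at hpx
      have hne : p.1.1 ≠ S.r ξ := hpx ▸ x.2
      have : p.1.2 ξ = S.f ξ x := by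
        rw [p.2 ξ hne]
        congr 1
        exact Subtype.ext hpx
      rw [this]
      exact hyV
  obtain ⟨p, hpL, hp⟩ := hmem
  simp only [Prod.mk.injEq] at hp
  have h1 := S.eq_fibrePoint p.2 hp.1
  rw [hp.2] at h1
  convert hpL using 1
  exact Subtype.ext h1.symm

/-- Only the coordinates `ξ` with `r ξ` in the projection of `L` are needed to separate the points
of `L`; if the projection is countable, then `L` embeds in a countable product. -/
lemma metrizableSpace_of_countable [T3Space M] [SecondCountableTopology M]
    [T3Space Y] [SecondCountableTopology Y]
    (S : SplittingFamily M (fun _ : ι => Y)) {L : Set S.split} (hL : IsCompact L)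
    (hc : ((fun p : S.split => p.1.1) '' L).Countable) : TopologicalSpace.MetrizableSpace L := by
  set J : Set ι := S.r ⁻¹' ((fun p : S.split => p.1.1) '' L) with hJ
  have : Countable J := (hc.preimage S.r_injective).to_subtype
  have : CompactSpace L := isCompact_iff_compactSpace.1 hL
  have h0 : Continuous fun p : L => p.1.1 := continuous_subtype_val.comp continuous_subtype_val
  have h1 : Continuous fun p : L => p.1.1.2 := continuous_snd.comp h0
  have hcont : Continuous fun p : L => (p.1.1.1, fun j : J => p.1.1.2 j) :=
    (continuous_fst.comp h0).prodMk (continuous_pi fun j => (continuous_apply j.1).comp h1)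
  refine (hcont.isClosedEmbedding ?_).isEmbedding.metrizableSpace
  rintro ⟨⟨⟨m, x⟩, hp⟩, hpL⟩ ⟨⟨⟨m', x'⟩, hq⟩, hqL⟩ h
  simp only [Prod.mk.injEq] at h
  obtain ⟨rfl, hx⟩ := h
  have : x = x' := by
    funext ξ
    by_cases hξ : ξ ∈ J
    · exact congrFun hx ⟨ξ, hξ⟩
    · have hne : m ≠ S.r ξ := fun h => hξ ⟨_, hpL, h⟩
      exact (hp ξ hne).trans (hq ξ hne).symm
  subst this
  rfl

/-- The split of `M` has dimension at most `n ≥ 1` if `M` and `Y` have dimensions at most `1` and `n`.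
Its projection to finitely many coordinates `J` consists of the fibres over the points `r j`, which
embed in `Y`, and a rest, the closed subsets of which embed in `M`. -/
lemma coveringDimLE_split [CompactSpace M] [T2Space M] [CompactSpace Y] [T2Space Y]
    (S : SplittingFamily M (fun _ : ι => Y)) {n : ℕ} (hn : 1 ≤ n) (hM : CoveringDimLE M 1)
    (hY : CoveringDimLE Y n) : CoveringDimLE S.split n := by
  have := S.compactSpace_split
  have hcont : Continuous fun p : S.split => p.1.2 := continuous_snd.comp continuous_subtype_val
  refine coveringDimLE_of_finite_coordinates (fun p : S.split => p.1.1) (fun p => p.1.2)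
    IsInducing.subtypeVal fun J => ?_
  set P : Set (M × (J → Y)) := range fun p : S.split => (p.1.1, fun j : J => p.1.2 j) with hP
  have hPeq : ∀ y ∈ P, ∀ (j : J) (h : y.1 ≠ S.r j), y.2 j = S.f j ⟨y.1, h⟩ := by
    rintro _ ⟨p, rfl⟩ j h
    exact p.2 j h
  have hPcomp : CompactSpace P := by
    refine isCompact_iff_compactSpace.1 (isCompact_range ?_)
    exact (continuous_fst.comp continuous_subtype_val).prodMk
      (continuous_pi fun j => (continuous_apply j.1).comp hcont)
  have hfst : Continuous fun y : P => y.1.1 := continuous_fst.comp continuous_subtype_val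
  have hsnd : Continuous fun y : P => y.1.2 := continuous_snd.comp continuous_subtype_val
  have hA : CoverOrderLEOn (⋃ j : J, {y : P | y.1.1 = S.r j}) n := by
    refine CoverOrderLEOn.iUnion fun j => ?_
    have hcl : IsClosed {y : P | y.1.1 = S.r j} := isClosed_eq hfst continuous_const
    refine CoverOrderLEOn.of_isClosed hcl ?_
    have : CompactSpace {y : P | y.1.1 = S.r j} := isCompact_iff_compactSpace.1 hcl.isCompact
    have hc : Continuous fun y : {y : P | y.1.1 = S.r j} => y.1.1.2 j :=
      (continuous_apply j).comp (hsnd.comp continuous_subtype_val)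
    refine hY.of_isClosedEmbedding (hc.isClosedEmbedding ?_)
    rintro ⟨⟨⟨m, x⟩, hx⟩, hm⟩ ⟨⟨⟨m', x'⟩, hx'⟩, hm'⟩ h
    obtain rfl : m = S.r j := hm
    obtain rfl : m' = S.r j := hm'
    have : x = x' := by
      funext k
      rcases eq_or_ne k j with rfl | hkj
      · exact h
      · have hne : S.r j ≠ S.r k := S.r_injective.ne fun h => hkj (Subtype.ext h.symm)
        exact (hPeq _ hx k hne).trans (hPeq _ hx' k hne).symm
    subst this
    rfl
  refine hA.coveringDimLE fun C hC hCA => ?_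
  have : CompactSpace C := isCompact_iff_compactSpace.1 hC.isCompact
  have hc : Continuous fun y : C => y.1.1.1 := hfst.comp continuous_subtype_val
  refine (hM.of_isClosedEmbedding (hc.isClosedEmbedding ?_)).mono hn
  rintro ⟨⟨⟨m, x⟩, hx⟩, hm⟩ ⟨⟨⟨m', x'⟩, hx'⟩, hm'⟩ h
  obtain rfl : m = m' := h
  have : x = x' := by
    funext k
    have hne : m ≠ S.r k := fun h => disjoint_left.1 hCA hm (mem_iUnion.2 ⟨k, h⟩)
    exact (hPeq _ hx k hne).trans (hPeq _ hx' k hne).symm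
  subst this
  rfl

end SplittingFamily

/-! ### Nonmetrizability from separated functions, and the choice of the space -/

/-- In the separable space `C(X, ℝ)` of a metrizable compact space, distances between the members of
an uncountable family are not bounded away from `0`. -/
lemma not_metrizableSpace_of_separated {X κ : Type} [TopologicalSpace X] [CompactSpace X]
    [Uncountable κ] (g : κ → C(X, ℝ)) {ε : ℝ} (hε : 0 < ε)
    (hg : ∀ i j, i ≠ j → ∃ x, ε ≤ |g i x - g j x|) : ¬ TopologicalSpace.MetrizableSpace X := by
  intro hX
  let _ := TopologicalSpace.metrizableSpaceMetric X
  have hdisj : Pairwise (Function.onFun Disjoint fun i => Metric.ball (g i) (ε / 2)) := by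
    intro i j hij
    obtain ⟨x, hx⟩ := hg i j hij
    refine Metric.ball_disjoint_ball ?_
    rw [add_halves]
    exact hx.trans (ContinuousMap.dist_apply_le_dist (f := g i) (g := g j) x)
  exact not_countable (hdisj.countable_of_isOpen_disjoint (fun _ => Metric.isOpen_ball)
    fun i => ⟨g i, Metric.mem_ball_self (half_pos hε)⟩)

theorem mainTheorem6 (n : ℕ∞) :
    ∃ (X : Type) (_ : TopologicalSpace X),
      CompactSpace X ∧ T2Space X ∧ ¬ TopologicalSpace.MetrizableSpace X ∧
      (n ≠ 0 → ∃ (ι : Type) (S : SplittingFamily unitInterval (fun _ : ι => Cube n)),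
        Nonempty (X ≃ₜ S.split)) ∧
      ∀ L : Set X, IsCompact L → ¬ TopologicalSpace.MetrizableSpace L →
        coveringDim L = (n : WithBot ℕ∞) ∧ ∃ g : Cube n → L, IsEmbedding g := by
  rcases eq_or_ne n 0 with rfl | hn
  · have : IsEmpty {i : ℕ // (i : ℕ∞) < (0 : ℕ∞)} := ⟨fun i => not_lt_bot i.2⟩
    refine ⟨ℝ → Bool, inferInstance, inferInstance, inferInstance, ?_, fun h => absurd rfl h, ?_⟩
    · refine not_metrizableSpace_of_separated (κ := ℝ)
        (fun t => ⟨fun x => if x t then 1 else 0,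
          (continuous_of_discreteTopology (f := fun b : Bool => if b then (1 : ℝ) else 0)).comp
            (continuous_apply t)⟩) one_pos fun s t hst => ⟨fun u => decide (u = s), ?_⟩
      simp [hst.symm]
    · intro L hL hLm
      have : CompactSpace L := isCompact_iff_compactSpace.1 hL
      obtain ⟨p⟩ : Nonempty L := by
        by_contra hne
        rw [not_nonempty_iff] at hne
        exact hLm inferInstance
      have hg : IsEmbedding fun _ : Cube 0 => p := .of_subsingleton _
      refine ⟨coveringDim_eq hg fun m hm => ?_, _, hg⟩
      obtain rfl : m = 0 := by exact_mod_cast hm.symm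
      refine coveringDimLE_of_finite_coordinates (fun _ : L => ()) (fun x => x.1) ?_ fun J => ?_
      · refine .of_comp (by fun_prop) continuous_snd IsInducing.subtypeVal
      · intro 𝒰 _ _ hc
        refine ⟨range singleton, finite_range _, fun _ _ => isOpen_discrete _, ?_, ?_, fun x => ?_⟩
        · rw [sUnion_range, iUnion_of_singleton]
        · rintro _ ⟨x, rfl⟩
          obtain ⟨U, hU, hx⟩ := mem_sUnion.1 (hc ▸ mem_univ x : x ∈ ⋃₀ 𝒰)
          exact ⟨U, hU, singleton_subset_iff.2 hx⟩
        · refine le_trans (encard_le_encard (t := {{x}}) ?_) (by simp)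
          rintro _ ⟨⟨y, rfl⟩, hy⟩
          rw [mem_singleton_iff.1 hy]
          rfl
  · obtain ⟨S, hS⟩ := exists_splittingFamily (Cube n)
    have := S.compactSpace_split
    refine ⟨S.split, inferInstance, inferInstance, inferInstance, ?_,
      fun _ => ⟨_, S, ⟨Homeomorph.refl _⟩⟩, ?_⟩
    · set i₀ : {i : ℕ // (i : ℕ∞) < n} := ⟨0, by simpa [pos_iff_ne_zero] using hn⟩
      refine not_metrizableSpace_of_separated (κ := UncountableClosed)
        (fun ξ => ⟨fun p => (p.1.2 ξ i₀ : ℝ), by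
          have h1 : Continuous fun p : S.split => p.1.2 :=
            continuous_snd.comp continuous_subtype_val
          fun_prop⟩) (ε := 1 / 2) (by norm_num) fun ξ η hξη => ?_
      have hp : ∀ t : Cube n, S.fibrePoint ξ t ∈ S.split := S.fibrePoint_mem ξ
      by_contra! hcon
      -- over `r ξ` the coordinate `η` is constant, while the coordinate `ξ` takes all values
      have h0 := hcon ⟨S.fibrePoint ξ 0, hp 0⟩
      have h1 := hcon ⟨S.fibrePoint ξ 1, hp 1⟩
      simp only [ContinuousMap.coe_mk, S.fibrePoint_self, S.fibrePoint_of_ne hξη 1 0] at h0 h1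
      simp only [Pi.zero_apply, Pi.one_apply, Icc.coe_zero, Icc.coe_one, abs_lt] at h0 h1
      linarith [h0.1, h1.2]
    · intro L hL hLm
      have : CompactSpace L := isCompact_iff_compactSpace.1 hL
      set F : UncountableClosed := ⟨(fun p : S.split => p.1.1) '' L,
        (hL.image (continuous_fst.comp continuous_subtype_val)).isClosed,
        fun hc => hLm (S.metrizableSpace_of_countable hL hc)⟩
      set g : Cube n → L := fun t => ⟨⟨S.fibrePoint F t, S.fibrePoint_mem F t⟩,
        S.fibrePoint_mem_of_isCompact hL (hS F).2 t⟩ with hgdef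
      have hgc : Continuous g := ((S.continuous_fibrePoint F).subtype_mk _).subtype_mk _
      have hg : IsEmbedding g := by
        refine (hgc.isClosedEmbedding fun s t hst => ?_).isEmbedding
        have h1 : S.fibrePoint F s = S.fibrePoint F t :=
          congrArg (fun q : L => q.1.1) hst
        rw [← S.fibrePoint_self F s, h1, S.fibrePoint_self]
      refine ⟨coveringDim_eq hg fun m hm => ?_, g, hg⟩
      subst hm
      have hm : 1 ≤ m := Nat.one_le_iff_ne_zero.2 fun h => hn (by simp [h])
      exact (S.coveringDimLE_split hm coveringDimLE_unitInterval
        (coveringDimLE_Cube m)).of_isClosedEmbedding hL.isClosed.isClosedEmbedding_subtypeVal
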